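/- Identify partitions with Young diagrams; parts of size $0$ are ignored. For partitions $\mu,\nu,\lambda$ let $c_{\mu,\nu}^{\lambda}$ be the Littlewood–Richardson coefficient, i.e. the number of semistandard fillings, by positive integers, of the skew shape $\lambda/\mu$ that have content $\nu$ and whose reading word (rows from top to bottom, each row read from right to left) is ballot: in every initial segment, each $i\ge 1$ occurs at least as often as $i+1$ (and $c_{\mu,\nu}^{\lambda}=0$ if $\mu\not\subseteq\lambda$). The Newell–Littlewood number is $$N_{\mu,\nu,\lambda}=\sum_{\alpha,\beta,\gamma} c_{\alpha,\beta}^{\mu}\,c_{\alpha,\gamma}^{\nu}\,c_{\beta,\gamma}^{\lambda},$$ where the sum runs over all partitions $\alpha,\beta,\gamma$ (only finitely many terms are nonzero). Write $|\lambda|$ for the sum of the parts of $\lambda$, and $k\lambda=(k\lambda_1,k\lambda_2,\ldots)$. **Theorem 5.6.** Let $\lambda,\mu,\nu$ be partitions with $|\lambda|+|\mu|+|\nu|\equiv 0 \pmod 2$, and suppose that at least one of $\lambda,\mu,\nu$ is a single row $(p)$ or a single column $(1^p)$, where $p\ge 0$. Let $k\ge 1$ be an integer with $N_{k\mu,k\nu,k\lambda}>0$.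 Then $N_{\mu,\nu,\lambda}>0$, and there exist partitions $\alpha,\beta,\gamma$ such that $$c_{k\alpha,k\beta}^{k\mu}\;c_{k\alpha,k\gamma}^{k\nu}\;c_{k\beta,k\gamma}^{k\lambda}>0.$$ -/

import Mathlib

/-! Partitions are Mathlib's Young diagrams (English convention). A cell is a pair
`(row, column)`, both numbered from `0`; `μ.rowLen i` is the part of `μ` with index `i + 1`,
and `μ.card` is the size `|μ|`. -/

namespace NewellLittlewood

/-- The cells of the skew shape `lam / mu`. -/
def skewCells (lam mu : YoungDiagram) : Finset (ℕ × ℕ) :=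
  lam.cells \ mu.cells

/-- The cells of `lam / mu` that are read up to and including the cell `c` when the shape is
read row by row from top to bottom, each row from right to left. -/
def readUpTo (lam mu : YoungDiagram) (c : ℕ × ℕ) : Finset (ℕ × ℕ) :=
  {d ∈ skewCells lam mu | d.1 < c.1 ∨ (d.1 = c.1 ∧ c.2 ≤ d.2)}

/-- A Littlewood-Richardson tableau: a ballot semistandard filling, by positive integers, of the
skew shape `lam / mu` (where `mu ⊆ lam`), with content `nu`. For extensionality the filling is
a function on `ℕ × ℕ` which is `0` outside the shape. -/
@[ext]
structure LRTableau (lam mu nu : YoungDiagram) where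
  /-- `entry c` is the label of the box `c`. -/
  entry : ℕ × ℕ → ℕ
  inner_le_outer : mu ≤ lam
  entry_pos : ∀ c ∈ skewCells lam mu, 0 < entry c
  entry_eq_zero : ∀ c ∉ skewCells lam mu, entry c = 0
  /-- Rows are weakly increasing from left to right. -/
  row_weak : ∀ i j₁ j₂ : ℕ, j₁ < j₂ → (i, j₁) ∈ skewCells lam mu → (i, j₂) ∈ skewCells lam mu →
    entry (i, j₁) ≤ entry (i, j₂)
  /-- Columns are strictly increasing from top to bottom. -/
  col_strict : ∀ i₁ i₂ j : ℕ, i₁ < i₂ → (i₁, j) ∈ skewCells lam mu → (i₂, j) ∈ skewCells lam mu →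
    entry (i₁, j) < entry (i₂, j)
  /-- The label `m + 1` is used as often as the part of `nu` with index `m + 1` says. -/
  content : ∀ m : ℕ, ({c ∈ skewCells lam mu | entry c = m + 1} : Finset (ℕ × ℕ)).card = nu.rowLen m
  /-- In every nonempty initial segment of the reading word (right to left, top to bottom) the
  label `m + 1` occurs at least as often as the label `m + 2`. -/
  ballot : ∀ c ∈ skewCells lam mu, ∀ m : ℕ,
    ({d ∈ readUpTo lam mu c | entry d = m + 2} : Finset (ℕ × ℕ)).card ≤
      ({d ∈ readUpTo lam mu c | entry d = m + 1} : Finset (ℕ × ℕ)).card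

/-- The Littlewood-Richardson coefficient `c_{mu, nu}^{lam}`: the number of Littlewood-Richardson
tableaux of shape `lam / mu` and content `nu`. -/
noncomputable def lrCoeff (mu nu lam : YoungDiagram) : ℕ :=
  Nat.card (LRTableau lam mu nu)

theorem LRTableau.entry_le {lam mu nu : YoungDiagram} (T : LRTableau lam mu nu) (c : ℕ × ℕ) :
    T.entry c ≤ nu.colLen 0 := by
  by_cases hc : c ∈ skewCells lam mu
  · have hpos := T.entry_pos c hc
    obtain ⟨m, hm⟩ : ∃ m, T.entry c = m + 1 := ⟨T.entry c - 1, by omega⟩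
    have h1 : 0 < nu.rowLen m := by
      rw [← T.content m]
      exact Finset.card_pos.mpr ⟨c, Finset.mem_filter.mpr ⟨hc, hm⟩⟩
    have h2 : m < nu.colLen 0 :=
      YoungDiagram.mem_iff_lt_colLen.mp (YoungDiagram.mem_iff_lt_rowLen.mpr h1)
    omega
  · rw [T.entry_eq_zero c hc]
    exact Nat.zero_le _

/-- There are only finitely many tableaux, so that `Nat.card` counts them. -/
instance LRTableau.finite (lam mu nu : YoungDiagram) : Finite (LRTableau lam mu nu) := by
  let f : LRTableau lam mu nu → (skewCells lam mu → Fin (nu.colLen 0 + 1)) :=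
    fun T c => ⟨T.entry c, Nat.lt_succ_of_le (T.entry_le c)⟩
  refine Finite.of_injective f fun T U h => ?_
  ext c
  by_cases hc : c ∈ skewCells lam mu
  · have := congrFun h ⟨c, hc⟩
    exact congrArg Fin.val this
  · rw [T.entry_eq_zero c hc, U.entry_eq_zero c hc]

theorem LRTableau.card_content_le {lam mu nu : YoungDiagram} (T : LRTableau lam mu nu) :
    nu.card ≤ lam.card := by
  have h1 : nu.card = ∑ m ∈ Finset.range (nu.colLen 0), nu.rowLen m := by
    have hmaps : ∀ c ∈ nu.cells, c.1 ∈ Finset.range (nu.colLen 0) := by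
      intro c hc
      rw [Finset.mem_range, ← YoungDiagram.mem_iff_lt_colLen]
      exact nu.up_left_mem le_rfl (Nat.zero_le c.2) hc
    rw [YoungDiagram.card, Finset.card_eq_sum_card_fiberwise hmaps]
    exact Finset.sum_congr rfl fun m _ => (nu.rowLen_eq_card (i := m)).symm
  rw [h1]
  simp_rw [← T.content]
  rw [← Finset.card_biUnion]
  · refine Finset.card_le_card fun c hc => ?_
    obtain ⟨m, _, hm⟩ := Finset.mem_biUnion.mp hc
    exact (Finset.mem_sdiff.mp (Finset.mem_filter.mp hm).1).1
  · intro m _ m' _ hne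
    refine Finset.disjoint_left.mpr fun c h h' => hne ?_
    have := (Finset.mem_filter.mp h).2
    have := (Finset.mem_filter.mp h').2
    omega

/-- The Newell-Littlewood number `N_{mu, nu, lam}`, the sum of
`c_{α, β}^{mu} * c_{α, γ}^{nu} * c_{β, γ}^{lam}` over all triples of partitions `(α, β, γ)`. -/
noncomputable def nlNumber (mu nu lam : YoungDiagram) : ℕ :=
  ∑ᶠ t : YoungDiagram × YoungDiagram × YoungDiagram,
    lrCoeff t.1 t.2.1 mu * lrCoeff t.1 t.2.2 nu * lrCoeff t.2.1 t.2.2 lam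

theorem card_le_of_lrCoeff_ne_zero {mu nu lam : YoungDiagram} (h : lrCoeff mu nu lam ≠ 0) :
    mu.card ≤ lam.card ∧ nu.card ≤ lam.card := by
  obtain ⟨⟨T⟩, _⟩ := Nat.card_ne_zero.mp h
  exact ⟨Finset.card_le_card T.inner_le_outer, T.card_content_le⟩

theorem finite_card_le (n : ℕ) : {mu : YoungDiagram | mu.card ≤ n}.Finite := by
  refine Set.Finite.of_finite_image (f := YoungDiagram.cells) ?_
    (fun a _ b _ h => YoungDiagram.ext h)
  refine ((Finset.range n ×ˢ Finset.range n).powerset.finite_toSet).subset ?_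
  rintro _ ⟨mu, hmu, rfl⟩
  rw [Finset.mem_coe, Finset.mem_powerset]
  rintro ⟨i, j⟩ hc
  have hsub : Finset.range (i + 1) ×ˢ Finset.range (j + 1) ⊆ mu.cells := by
    rintro ⟨a, b⟩ hab
    simp only [Finset.mem_product, Finset.mem_range] at hab
    exact mu.up_left_mem (by omega) (by omega) hc
  have hle := Finset.card_le_card hsub
  rw [Finset.card_product, Finset.card_range, Finset.card_range] at hle
  have hn : mu.cells.card ≤ n := hmu
  simp only [Finset.mem_product, Finset.mem_range]
  constructor <;> nlinarith

/-- Only finitely many triples contribute, so that the finite sum above is the true sum. -/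
theorem nlNumber_support_finite (mu nu lam : YoungDiagram) :
    (Function.support fun t : YoungDiagram × YoungDiagram × YoungDiagram =>
      lrCoeff t.1 t.2.1 mu * lrCoeff t.1 t.2.2 nu * lrCoeff t.2.1 t.2.2 lam).Finite := by
  refine ((finite_card_le mu.card).prod ((finite_card_le mu.card).prod
    (finite_card_le nu.card))).subset ?_
  intro t ht
  have h12 := left_ne_zero_of_mul (Function.mem_support.mp ht)
  have h1 := card_le_of_lrCoeff_ne_zero (left_ne_zero_of_mul h12)
  have h2 := card_le_of_lrCoeff_ne_zero (right_ne_zero_of_mul h12)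
  exact ⟨h1.1, h1.2, h2.2⟩

/-- The partition `k mu`, each part of which is `k` times the corresponding part of `mu`. -/
def scale (k : ℕ) (mu : YoungDiagram) : YoungDiagram :=
  YoungDiagram.ofRowLens (mu.rowLens.map (k * ·))
    (List.Pairwise.sortedGE (List.pairwise_map.mpr
      (mu.rowLens_sorted.pairwise.imp fun h => Nat.mul_le_mul_left k h)))

theorem rowLen_scale (k : ℕ) (mu : YoungDiagram) (i : ℕ) :
    (scale k mu).rowLen i = k * mu.rowLen i := by
  have key : ∀ j, j < (scale k mu).rowLen i ↔ j < k * mu.rowLen i := by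
    intro j
    rw [← YoungDiagram.mem_iff_lt_rowLen, scale, YoungDiagram.mem_ofRowLens]
    simp only [List.length_map, YoungDiagram.length_rowLens, List.getElem_map,
      YoungDiagram.get_rowLens, exists_prop, and_iff_right_iff_imp]
    intro h
    rw [← YoungDiagram.mem_iff_lt_colLen, YoungDiagram.mem_iff_lt_rowLen]
    by_contra h0
    have : mu.rowLen i = 0 := by omega
    simp [this] at h
  exact le_antisymm (Nat.le_of_not_lt fun h => lt_irrefl _ ((key _).mp h))
    (Nat.le_of_not_lt fun h => lt_irrefl _ ((key _).mpr h))

/-- `mu = (p)` for some `p ≥ 0`: there is at most one nonempty row. -/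
def IsSingleRow (mu : YoungDiagram) : Prop :=
  mu.colLen 0 ≤ 1

/-- `mu = (1, …, 1)`, with any number `t ≥ 0` of parts: there is at most one nonempty column. -/
def IsSingleColumn (mu : YoungDiagram) : Prop :=
  mu.rowLen 0 ≤ 1

end NewellLittlewood

open NewellLittlewood

/-! ### Row lengths, and inequalities forced by a Littlewood–Richardson tableau -/

namespace NewellLittlewood

/-! Let π be the row or column among the three partitions, ρ and σ the other two. A nonzero term of
the scaled sum provides τ', β', γ', where τ' is shared by kρ and kσ, while β' and γ' lie inside kπ.
If π is a row, so are β' and γ', and Weyl's inequalities give kρ_{i+1} ≤ τ'_i ≤ kρ_i, and likewise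
for σ. If π is a column, β' and γ' have parts at most k, so k(ρ_i − 1) ≤ τ'_i ≤ kρ_i. Thus τ' lies
between kL and kU, where L and U are partitions built from ρ and σ alone.

Comparing sizes gives |τ'| = kn with 2n = |ρ| + |σ| − |π|; parity makes n an integer. Hence |L| ≤ n
≤ |U|, and removing corners of U outside L produces τ of size n between L and U
(`exists_card_eq_between`). Now ρ/τ and σ/τ are horizontal (vertical) strips, so Pieri's rule makes
all three coefficients positive, with β and γ rows (columns) of the remaining sizes.

Only necessary inequalities (`WeylSum`) are taken from the given tableaux, and only Pieri cases are
constructed. Tableaux are built as chains of shapes, whose defining conditions are linear and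
homogeneous; the same chains multiplied by k give the scaled triple. -/

theorem card_eq_sum_rowLen (mu : YoungDiagram) {R : ℕ} (hR : mu.colLen 0 ≤ R) :
    mu.card = ∑ i ∈ Finset.range R, mu.rowLen i := by
  have hmaps : ∀ c ∈ mu.cells, c.1 ∈ Finset.range R := by
    intro c hc
    rw [Finset.mem_range]
    refine lt_of_lt_of_le ?_ hR
    rw [← YoungDiagram.mem_iff_lt_colLen]
    exact mu.up_left_mem le_rfl (Nat.zero_le c.2) hc
  rw [YoungDiagram.card, Finset.card_eq_sum_card_fiberwise hmaps]
  exact Finset.sum_congr rfl fun m _ => (mu.rowLen_eq_card (i := m)).symm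

theorem rowLen_pos_iff {mu : YoungDiagram} {i : ℕ} : 0 < mu.rowLen i ↔ i < mu.colLen 0 := by
  rw [← YoungDiagram.mem_iff_lt_colLen, YoungDiagram.mem_iff_lt_rowLen]

theorem rowLen_eq_zero {mu : YoungDiagram} {i : ℕ} (h : mu.colLen 0 ≤ i) : mu.rowLen i = 0 := by
  by_contra h0
  have := rowLen_pos_iff.mp (Nat.pos_of_ne_zero h0)
  omega

theorem le_iff_rowLen_le {mu lam : YoungDiagram} :
    mu ≤ lam ↔ ∀ i, mu.rowLen i ≤ lam.rowLen i := by
  constructor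
  · intro h i
    by_contra! hlt
    exact lt_irrefl _ (YoungDiagram.mem_iff_lt_rowLen.mp (h (YoungDiagram.mem_iff_lt_rowLen.mpr hlt)))
  · rintro h ⟨i, j⟩ hc
    exact YoungDiagram.mem_iff_lt_rowLen.mpr
      ((YoungDiagram.mem_iff_lt_rowLen.mp hc).trans_le (h i))

theorem mem_skewCells {lam mu : YoungDiagram} {i j : ℕ} :
    (i, j) ∈ skewCells lam mu ↔ j < lam.rowLen i ∧ mu.rowLen i ≤ j := by
  simp [skewCells, YoungDiagram.mem_iff_lt_rowLen]

theorem mem_readUpTo {lam mu : YoungDiagram} {c d : ℕ × ℕ} :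
    d ∈ readUpTo lam mu c ↔ d ∈ skewCells lam mu ∧ (d.1 < c.1 ∨ (d.1 = c.1 ∧ c.2 ≤ d.2)) := by
  simp [readUpTo]

/-- Elementary necessary conditions for `lam` to occur in the product of `mu` and `nu`: the sizes
add up, both factors are contained in `lam`, and Weyl's inequalities hold. -/
structure WeylSum (mu nu lam : YoungDiagram) : Prop where
  card_eq : lam.card = mu.card + nu.card
  left_le : ∀ i, mu.rowLen i ≤ lam.rowLen i
  right_le : ∀ i, nu.rowLen i ≤ lam.rowLen i
  weyl : ∀ i j, lam.rowLen (i + j) ≤ mu.rowLen i + nu.rowLen j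

theorem WeylSum.symm {mu nu lam : YoungDiagram} (h : WeylSum mu nu lam) : WeylSum nu mu lam where
  card_eq := by rw [h.card_eq, add_comm]
  left_le := h.right_le
  right_le := h.left_le
  weyl i j := by rw [add_comm i j, add_comm (nu.rowLen i)]; exact h.weyl j i

namespace LRTableau

variable {lam mu nu : YoungDiagram}

theorem card_eq (T : LRTableau lam mu nu) : lam.card = mu.card + nu.card := by
  have h1 : (skewCells lam mu).card = nu.card := by
    have hmaps : ∀ c ∈ skewCells lam mu, T.entry c - 1 ∈ Finset.range (nu.colLen 0) := by
      intro c hc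
      have h1 := T.entry_pos c hc
      have h2 := T.entry_le c
      rw [Finset.mem_range]
      omega
    rw [card_eq_sum_rowLen nu le_rfl, Finset.card_eq_sum_card_fiberwise hmaps]
    refine Finset.sum_congr rfl fun m _ => ?_
    rw [← T.content m]
    congr 1
    refine Finset.filter_congr fun c hc => ?_
    have := T.entry_pos c hc
    omega
  have h2 := Finset.card_sdiff_add_card_eq_card (s := mu.cells) (t := lam.cells) T.inner_le_outer
  rw [skewCells] at h1
  simp only [YoungDiagram.card] at *
  omega

/-- By the ballot condition a label m + 2 is preceded in the reading word by some m + 1. That box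
cannot lie further right in the same row, since rows increase weakly, so it lies in a higher row;
induct on the label. -/
theorem le_row (T : LRTableau lam mu nu) {m : ℕ} : ∀ c ∈ skewCells lam mu, T.entry c = m + 1 → m ≤ c.1 := by
  induction m with
  | zero => exact fun c _ _ => Nat.zero_le _
  | succ m ih =>
    intro c hc he
    have h1 : 0 < ({d ∈ readUpTo lam mu c | T.entry d = m + 1} : Finset (ℕ × ℕ)).card := by
      refine lt_of_lt_of_le ?_ (T.ballot c hc m)
      exact Finset.card_pos.mpr ⟨c, Finset.mem_filter.mpr
        ⟨mem_readUpTo.mpr ⟨hc, Or.inr ⟨rfl, le_rfl⟩⟩, he⟩⟩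
    obtain ⟨d, hd⟩ := Finset.card_pos.mp h1
    obtain ⟨hd1, hd2⟩ := Finset.mem_filter.mp hd
    obtain ⟨hd3, hd4⟩ := mem_readUpTo.mp hd1
    have h2 := ih d hd3 hd2
    rcases hd4 with h | ⟨h, h'⟩
    · omega
    · obtain ⟨i, j⟩ := c
      obtain ⟨i', j'⟩ := d
      simp only at h h'
      subst h
      rcases h'.eq_or_lt with h'' | h''
      · subst h''
        omega
      · have := T.row_weak _ _ _ h'' hc hd3
        omega

/-- Boxes labelled m + 1 lie in distinct columns, and by `le_row` in rows of index at least m, hence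
in columns that meet row m of `lam`. -/
theorem rowLen_content_le (T : LRTableau lam mu nu) (m : ℕ) : nu.rowLen m ≤ lam.rowLen m := by
  rw [← T.content m]
  conv_rhs => rw [← Finset.card_range (lam.rowLen m)]
  refine Finset.card_le_card_of_injOn Prod.snd ?_ ?_
  · rintro ⟨i, j⟩ hc
    obtain ⟨h1, h2⟩ := Finset.mem_filter.mp hc
    have h3 : m ≤ i := T.le_row _ h1 h2
    have h4 := (mem_skewCells.mp h1).1
    simp only [Finset.coe_range, Set.mem_Iio]
    exact h4.trans_le (lam.rowLen_anti _ _ h3)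
  · rintro ⟨i, j⟩ hc ⟨i', j'⟩ hc' h
    obtain ⟨h1, h2⟩ := Finset.mem_filter.mp hc
    obtain ⟨h1', h2'⟩ := Finset.mem_filter.mp hc'
    simp only at h
    subst h
    rcases lt_trichotomy i i' with h | h | h
    · have := T.col_strict _ _ _ h h1 h1'
      omega
    · rw [h]
    · have := T.col_strict _ _ _ h h1' h1
      omega

theorem ballot_of_le (T : LRTableau lam mu nu) {c : ℕ × ℕ} (hc : c ∈ skewCells lam mu) {v w : ℕ}
    (hv : 0 < v) (hvw : v ≤ w) :
    ({d ∈ readUpTo lam mu c | T.entry d = w} : Finset (ℕ × ℕ)).card ≤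
      ({d ∈ readUpTo lam mu c | T.entry d = v} : Finset (ℕ × ℕ)).card := by
  induction w, hvw using Nat.le_induction with
  | base => exact le_rfl
  | succ w hw ih =>
    obtain ⟨m, rfl⟩ : ∃ m, w = m + 1 := ⟨w - 1, by omega⟩
    exact (T.ballot c hc m).trans ih

/-- When the box `(r, j)` is read, its label has been used at least once for each box of the
row `r` read so far. -/
theorem sub_le_card_readUpTo (T : LRTableau lam mu nu) (r : ℕ) :
    ∀ n j, j + n + 1 = lam.rowLen r → mu.rowLen r ≤ j →
    n + 1 ≤ ({d ∈ readUpTo lam mu (r, j) | T.entry d = T.entry (r, j)} : Finset (ℕ × ℕ)).card := by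
  intro n
  induction n with
  | zero =>
    intro j hj hm
    have hc : (r, j) ∈ skewCells lam mu := mem_skewCells.mpr ⟨by omega, hm⟩
    exact Finset.card_pos.mpr ⟨(r, j), Finset.mem_filter.mpr
      ⟨mem_readUpTo.mpr ⟨hc, Or.inr ⟨rfl, le_rfl⟩⟩, rfl⟩⟩
  | succ n ih =>
    intro j hj hm
    have hc : (r, j) ∈ skewCells lam mu := mem_skewCells.mpr ⟨by omega, hm⟩
    have hc' : (r, j + 1) ∈ skewCells lam mu := mem_skewCells.mpr ⟨by omega, by omega⟩
    have h1 := ih (j + 1) (by omega) (by omega)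
    -- The right neighbour has a label at least as large, so the ballot condition there transfers
    -- its count to the label of (r, j); the box (r, j) then adds one.
    have h2 := T.ballot_of_le hc' (T.entry_pos _ hc) (T.row_weak r j (j + 1) (by omega) hc hc')
    refine (Nat.succ_le_succ (h1.trans h2)).trans ?_
    rw [Nat.succ_eq_add_one]
    have hnot : (r, j) ∉ ({d ∈ readUpTo lam mu (r, j + 1) | T.entry d = T.entry (r, j)} :
        Finset (ℕ × ℕ)) := by
      simp [mem_readUpTo]
    rw [← Finset.card_insert_of_notMem hnot]
    refine Finset.card_le_card ?_
    intro d hd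
    rcases Finset.mem_insert.mp hd with rfl | hd
    · exact Finset.mem_filter.mpr ⟨mem_readUpTo.mpr ⟨hc, Or.inr ⟨rfl, le_rfl⟩⟩, rfl⟩
    · obtain ⟨hd1, hd2⟩ := Finset.mem_filter.mp hd
      obtain ⟨hd3, hd4⟩ := mem_readUpTo.mp hd1
      refine Finset.mem_filter.mpr ⟨mem_readUpTo.mpr ⟨hd3, ?_⟩, hd2⟩
      simp only at hd4 ⊢
      omega

theorem le_entry (T : LRTableau lam mu nu) {i c : ℕ} (hc : mu.rowLen i ≤ c) :
    ∀ t, c < lam.rowLen (i + t) → t + 1 ≤ T.entry (i + t, c) := by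
  intro t
  induction t with
  | zero => exact fun h => T.entry_pos _ (mem_skewCells.mpr ⟨h, hc⟩)
  | succ t ih =>
    intro h
    have h0 : c < lam.rowLen (i + t) := h.trans_le (lam.rowLen_anti _ _ (by omega))
    have h1 := ih h0
    have hm : ∀ t, mu.rowLen (i + t) ≤ c := fun t => (mu.rowLen_anti _ _ (by omega)).trans hc
    have := T.col_strict (i + t) (i + (t + 1)) c (by omega) (mem_skewCells.mpr ⟨h0, hm _⟩)
      (mem_skewCells.mpr ⟨h, hm _⟩)
    omega

/-- Consider the box of row i + j in column `mu.rowLen i`. Its column is already in the skew shape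
from row i on, so its label v + 1 is at least j + 1. The boxes of its row read so far force that
label to occur at least `lam.rowLen (i + j) - mu.rowLen i` times, and it occurs ν_v ≤ ν_j times in
all. -/
theorem weyl (T : LRTableau lam mu nu) (i j : ℕ) : lam.rowLen (i + j) ≤ mu.rowLen i + nu.rowLen j := by
  by_cases hlt : lam.rowLen (i + j) ≤ mu.rowLen i
  · omega
  push Not at hlt
  have hm : mu.rowLen (i + j) ≤ mu.rowLen i := mu.rowLen_anti _ _ (by omega)
  have h1 := T.le_entry le_rfl j hlt
  have h2 := T.sub_le_card_readUpTo (i + j) (lam.rowLen (i + j) - mu.rowLen i - 1)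
    (mu.rowLen i) (by omega) hm
  obtain ⟨v, hv⟩ : ∃ v, T.entry (i + j, mu.rowLen i) = v + 1 :=
    ⟨T.entry (i + j, mu.rowLen i) - 1, by omega⟩
  have h3 : ({d ∈ readUpTo lam mu (i + j, mu.rowLen i) | T.entry d = v + 1} :
      Finset (ℕ × ℕ)).card ≤ nu.rowLen v := by
    rw [← T.content v]
    exact Finset.card_le_card (Finset.filter_subset_filter _ (Finset.filter_subset _ _))
  have h4 : nu.rowLen v ≤ nu.rowLen j := nu.rowLen_anti _ _ (by omega)
  rw [hv] at h2
  omega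

end LRTableau

theorem WeylSum.of_lrCoeff {mu nu lam : YoungDiagram} (h : lrCoeff mu nu lam ≠ 0) :
    WeylSum mu nu lam := by
  obtain ⟨⟨T⟩, _⟩ := Nat.card_ne_zero.mp h
  exact ⟨T.card_eq, le_iff_rowLen_le.mp T.inner_le_outer, T.rowLen_content_le, T.weyl⟩

end NewellLittlewood

/-! ### Tableaux encoded as chains of shapes -/

namespace NewellLittlewood

/-- A chain of shapes `s 0 = mu, s 1, s 2, …` growing to `lam`, given by row lengths, in which
`s (m + 1) / s m` is a horizontal strip of size `nu.rowLen m`, with the ballot condition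
for the successive strips. It encodes a Littlewood-Richardson tableau: the boxes with
label `m + 1` are those of `s (m + 1) / s m`. -/
structure IsLRChain (mu nu lam : YoungDiagram) (s : ℕ → ℕ → ℕ) : Prop where
  zero : ∀ r, s 0 r = mu.rowLen r
  mono : ∀ m r, s m r ≤ s (m + 1) r
  top : ∀ m r, r < m → s m r = lam.rowLen r
  strip : ∀ m r, s (m + 1) (r + 1) ≤ s m r
  content : ∀ m, ∃ R₀, ∀ R, R₀ ≤ R →
    ∑ r ∈ Finset.range R, s (m + 1) r = ∑ r ∈ Finset.range R, s m r + nu.rowLen m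
  ballot : ∀ m R, ∑ r ∈ Finset.range (R + 1), s (m + 2) r + ∑ r ∈ Finset.range R, s m r ≤
    ∑ r ∈ Finset.range (R + 1), s (m + 1) r + ∑ r ∈ Finset.range R, s (m + 1) r

theorem IsLRChain.scale {mu nu lam : YoungDiagram} {s : ℕ → ℕ → ℕ} (h : IsLRChain mu nu lam s)
    (k : ℕ) : IsLRChain (scale k mu) (scale k nu) (scale k lam) fun m r => k * s m r where
  zero r := by rw [h.zero, rowLen_scale]
  mono m r := Nat.mul_le_mul_left k (h.mono m r)
  top m r hr := by rw [h.top m r hr, rowLen_scale]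
  strip m r := Nat.mul_le_mul_left k (h.strip m r)
  content m := by
    obtain ⟨R₀, hR₀⟩ := h.content m
    refine ⟨R₀, fun R hR => ?_⟩
    rw [← Finset.mul_sum, ← Finset.mul_sum, hR₀ R hR, rowLen_scale, mul_add]
  ballot m R := by
    simp only [← Finset.mul_sum, ← mul_add]
    exact Nat.mul_le_mul_left k (h.ballot m R)

namespace IsLRChain

variable {mu nu lam : YoungDiagram} {s : ℕ → ℕ → ℕ}

theorem monotone (h : IsLRChain mu nu lam s) (r : ℕ) : Monotone fun m => s m r :=
  monotone_nat_of_le_succ fun m => h.mono m r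

theorem antitone (h : IsLRChain mu nu lam s) (m : ℕ) : Antitone (s m) :=
  antitone_nat_of_succ_le fun r => (h.mono m (r + 1)).trans (h.strip m r)

theorem le_outer (h : IsLRChain mu nu lam s) (m r : ℕ) : s m r ≤ lam.rowLen r := by
  rw [← h.top (m + r + 1) r (by omega)]
  exact h.monotone r (by omega)

theorem inner_le (h : IsLRChain mu nu lam s) (m r : ℕ) : mu.rowLen r ≤ s m r := by
  rw [← h.zero r]
  exact h.monotone r (Nat.zero_le m)

/-- The label of a box in the tableau encoded by a chain. -/
noncomputable def entry (lam mu : YoungDiagram) (s : ℕ → ℕ → ℕ) (c : ℕ × ℕ) : ℕ :=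
  open Classical in if c ∈ skewCells lam mu then sInf {m | c.2 < s m c.1} else 0

theorem entry_le_iff (h : IsLRChain mu nu lam s) {i j : ℕ} (hc : (i, j) ∈ skewCells lam mu)
    (m : ℕ) : entry lam mu s (i, j) ≤ m ↔ j < s m i := by
  rw [entry, if_pos hc]
  constructor
  · intro hle
    have hne : {m | j < s m i}.Nonempty :=
      ⟨i + 1, by rw [Set.mem_ofPred_eq, h.top _ _ (Nat.lt_succ_self i)]
                 exact (mem_skewCells.mp hc).1⟩
    have hmem : j < s (sInf {m | j < s m i}) i := Nat.sInf_mem hne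
    exact hmem.trans_le (h.monotone i hle)
  · exact fun hlt => Nat.sInf_le hlt

theorem mem_entry_eq_iff (h : IsLRChain mu nu lam s) {i j m : ℕ} :
    (i, j) ∈ skewCells lam mu ∧ entry lam mu s (i, j) = m + 1 ↔ s m i ≤ j ∧ j < s (m + 1) i := by
  constructor
  · rintro ⟨hc, he⟩
    have h1 := h.entry_le_iff hc m
    have h2 := h.entry_le_iff hc (m + 1)
    omega
  · rintro ⟨h1, h2⟩
    have hc : (i, j) ∈ skewCells lam mu :=
      mem_skewCells.mpr ⟨h2.trans_le (h.le_outer _ _), (h.inner_le _ _).trans h1⟩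
    have h3 := h.entry_le_iff hc m
    have h4 := h.entry_le_iff hc (m + 1)
    exact ⟨hc, by omega⟩

/-- Translates the partial sums of a chain into label counts: large R gives the content, small R the
ballot condition. -/
theorem card_entry_eq (h : IsLRChain mu nu lam s) (m R : ℕ) :
    ({c ∈ skewCells lam mu | entry lam mu s c = m + 1 ∧ c.1 < R} : Finset (ℕ × ℕ)).card +
      ∑ r ∈ Finset.range R, s m r = ∑ r ∈ Finset.range R, s (m + 1) r := by
  have hcard : ({c ∈ skewCells lam mu | entry lam mu s c = m + 1 ∧ c.1 < R} :
      Finset (ℕ × ℕ)).card = ∑ r ∈ Finset.range R, (s (m + 1) r - s m r) := by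
    rw [Finset.card_eq_sum_card_fiberwise (f := Prod.fst) (t := Finset.range R)
      fun c hc => by
        simp only [Finset.coe_filter, Set.mem_ofPred_eq] at hc
        simpa using hc.2.2]
    refine Finset.sum_congr rfl fun r hr => ?_
    rw [← Nat.card_Ico, ← Finset.card_map (s := Finset.Ico (s m r) (s (m + 1) r))
      ⟨fun j => (r, j), Prod.mk_right_injective r⟩]
    refine congrArg Finset.card ?_
    ext ⟨i, j⟩
    have := h.mem_entry_eq_iff (i := i) (j := j) (m := m)
    simp only [Finset.mem_filter, Finset.mem_map, Finset.mem_Ico, Function.Embedding.coeFn_mk,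
      Prod.mk.injEq, Finset.mem_range] at hr ⊢
    constructor
    · rintro ⟨⟨h1, h2, _⟩, rfl⟩
      exact ⟨j, this.mp ⟨h1, h2⟩, rfl, rfl⟩
    · rintro ⟨j, h1, rfl, rfl⟩
      have := this.mpr h1
      exact ⟨⟨this.1, this.2, hr⟩, rfl⟩
  rw [hcard, ← Finset.sum_add_distrib]
  exact Finset.sum_congr rfl fun r _ => Nat.sub_add_cancel (h.mono m r)

/-- The Littlewood-Richardson tableau encoded by a chain. -/
noncomputable def toTableau (h : IsLRChain mu nu lam s) : LRTableau lam mu nu where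
  entry := entry lam mu s
  inner_le_outer := le_iff_rowLen_le.mpr fun r => (h.inner_le 0 r).trans (h.le_outer 0 r)
  entry_pos := by
    rintro ⟨i, j⟩ hc
    have h1 := h.entry_le_iff hc 0
    have h2 := (mem_skewCells.mp hc).2
    have h3 := h.zero i
    omega
  entry_eq_zero c hc := by rw [entry, if_neg hc]
  row_weak i j₁ j₂ hj h1 h2 :=
    (h.entry_le_iff h1 _).mpr (hj.trans ((h.entry_le_iff h2 _).mp le_rfl))
  col_strict := by
    intro i₁ i₂ j hi h1 h2
    have h3 := (h.entry_le_iff h2 _).mp le_rfl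
    cases hm : entry lam mu s (i₂, j) with
    | zero =>
      rw [hm, h.zero] at h3
      have := (mem_skewCells.mp h2).2
      omega
    | succ m =>
      obtain ⟨i, rfl⟩ : ∃ i, i₂ = i + 1 := ⟨i₂ - 1, by omega⟩
      rw [hm] at h3
      exact Nat.lt_succ_of_le ((h.entry_le_iff h1 m).mpr
        (h3.trans_le ((h.strip m i).trans (h.antitone m (by omega)))))
  content := by
    intro m
    obtain ⟨R₀, hR₀⟩ := h.content m
    have h1 := hR₀ (max R₀ (lam.colLen 0)) (le_max_left _ _)
    have h2 := h.card_entry_eq m (max R₀ (lam.colLen 0))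
    have h3 : ({c ∈ skewCells lam mu | entry lam mu s c = m + 1 ∧
        c.1 < max R₀ (lam.colLen 0)} : Finset (ℕ × ℕ)) =
        {c ∈ skewCells lam mu | entry lam mu s c = m + 1} := by
      refine Finset.filter_congr ?_
      rintro ⟨i, j⟩ hc
      refine and_iff_left ?_
      have := (mem_skewCells.mp hc).1
      exact lt_of_lt_of_le (rowLen_pos_iff.mp (Nat.zero_lt_of_lt this)) (le_max_right _ _)
    rw [h3] at h2
    omega
  ballot := by
    intro c hc m
    have h1 := h.card_entry_eq (m + 1) (c.1 + 1)
    have h2 := h.card_entry_eq m c.1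
    have h3 := h.ballot m c.1
    -- The chain condition compares labels m + 2 through the whole row of c with labels m + 1
    -- strictly above it, so it dominates the comparison at every box of that row.
    have h4 : ({d ∈ readUpTo lam mu c | entry lam mu s d = m + 2} : Finset (ℕ × ℕ)).card ≤
        ({d ∈ skewCells lam mu | entry lam mu s d = m + 1 + 1 ∧ d.1 < c.1 + 1} :
          Finset (ℕ × ℕ)).card := by
      refine Finset.card_le_card fun d hd => ?_
      simp only [Finset.mem_filter, mem_readUpTo] at hd ⊢
      exact ⟨hd.1.1, hd.2, by omega⟩
    have h5 : ({d ∈ skewCells lam mu | entry lam mu s d = m + 1 ∧ d.1 < c.1} :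
          Finset (ℕ × ℕ)).card ≤
        ({d ∈ readUpTo lam mu c | entry lam mu s d = m + 1} : Finset (ℕ × ℕ)).card := by
      refine Finset.card_le_card fun d hd => ?_
      simp only [Finset.mem_filter, mem_readUpTo] at hd ⊢
      exact ⟨⟨hd.1, Or.inl hd.2.2⟩, hd.2.1⟩
    have h6 : m + 1 + 1 = m + 2 := rfl
    rw [h6] at h1 h4
    omega

theorem lrCoeff_pos (h : IsLRChain mu nu lam s) : 0 < lrCoeff mu nu lam :=
  Nat.pos_of_ne_zero (Nat.card_ne_zero.mpr ⟨⟨h.toTableau⟩, inferInstance⟩)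

end IsLRChain

/-- There are chains encoding tableaux of shape `lam / mu` and content `nu`, and of shape
`lam / nu` and content `mu`. -/
def HasLRChains (mu nu lam : YoungDiagram) : Prop :=
  (∃ s, IsLRChain mu nu lam s) ∧ ∃ s, IsLRChain nu mu lam s

theorem HasLRChains.symm {mu nu lam : YoungDiagram} (h : HasLRChains mu nu lam) :
    HasLRChains nu mu lam :=
  ⟨h.2, h.1⟩

theorem HasLRChains.lrCoeff_pos {mu nu lam : YoungDiagram} (h : HasLRChains mu nu lam) :
    0 < lrCoeff mu nu lam :=
  h.1.elim fun _ hs => hs.lrCoeff_pos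

theorem HasLRChains.scale {mu nu lam : YoungDiagram} (h : HasLRChains mu nu lam) (k : ℕ) :
    HasLRChains (scale k mu) (scale k nu) (scale k lam) :=
  ⟨h.1.elim fun _ hs => ⟨_, hs.scale k⟩, h.2.elim fun _ hs => ⟨_, hs.scale k⟩⟩

end NewellLittlewood

/-! ### Pieri's rule: explicit chains for horizontal and vertical strips -/

namespace NewellLittlewood

open Finset in
-- E m is the number of boxes of `lam / nu` in rows of index at least m. The inner-shape chains are
-- written in terms of it.
theorem exists_strip_tails {lam nu : YoungDiagram} (h1 : ∀ i, nu.rowLen i ≤ lam.rowLen i) :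
    ∃ E : ℕ → ℕ, (∀ m, lam.rowLen m + E (m + 1) = nu.rowLen m + E m) ∧
      (∀ m, lam.colLen 0 ≤ m → E m = 0) ∧ E 0 + nu.card = lam.card := by
  have hcol : nu.colLen 0 ≤ lam.colLen 0 := by
    by_contra! hlt
    have h2 := rowLen_pos_iff.mpr hlt
    have h3 := rowLen_eq_zero (mu := lam) le_rfl
    have := h1 (lam.colLen 0)
    omega
  refine ⟨fun m => ∑ r ∈ Ico m (lam.colLen 0), (lam.rowLen r - nu.rowLen r), ?_, ?_, ?_⟩
  · intro m
    have := h1 m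
    rcases lt_or_ge m (lam.colLen 0) with h | h
    · simp only
      rw [Finset.sum_eq_sum_Ico_succ_bot h]
      omega
    · simp only
      rw [Ico_eq_empty_of_le h, Ico_eq_empty_of_le (by omega)]
      have := rowLen_eq_zero h
      simp only [sum_empty]
      omega
  · intro m hm
    simp only
    rw [Ico_eq_empty_of_le hm, sum_empty]
  · simp only
    rw [card_eq_sum_rowLen lam le_rfl, card_eq_sum_rowLen nu hcol, ← range_eq_Ico,
      ← sum_add_distrib]
    exact sum_congr rfl fun r _ => Nat.sub_add_cancel (h1 r)

theorem rowLen_of_isSingleRow {nu : YoungDiagram} (h : IsSingleRow nu) (m : ℕ) :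
    nu.rowLen m = if m = 0 then nu.card else 0 := by
  have h1 : ∀ i, nu.rowLen (i + 1) = 0 := fun i => rowLen_eq_zero (le_trans h (by omega))
  rw [card_eq_sum_rowLen nu h, Finset.sum_range_one]
  cases m with
  | zero => rfl
  | succ m => simp [h1]

theorem rowLen_of_isSingleColumn {nu : YoungDiagram} (h : IsSingleColumn nu) (m : ℕ) :
    nu.rowLen m = if m < nu.card then 1 else 0 := by
  have h1 : ∀ i, nu.rowLen i = if i < nu.colLen 0 then 1 else 0 := by
    intro i
    have h2 : nu.rowLen i ≤ 1 := (nu.rowLen_anti _ _ (Nat.zero_le i)).trans h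
    have h3 := rowLen_pos_iff (mu := nu) (i := i)
    split_ifs <;> omega
  have h4 : nu.card = nu.colLen 0 := by
    rw [card_eq_sum_rowLen nu le_rfl, Finset.sum_congr rfl fun i hi =>
      (h1 i).trans (if_pos (Finset.mem_range.mp hi))]
    simp
  rw [h4, h1]

/-- Every box carries the label 1, so the chain reaches `lam` in one step. -/
theorem isLRChain_horizontal_content {mu nu lam : YoungDiagram} (hnu : IsSingleRow nu)
    (hcard : lam.card = mu.card + nu.card) (h1 : ∀ i, mu.rowLen i ≤ lam.rowLen i)
    (h2 : ∀ i, lam.rowLen (i + 1) ≤ mu.rowLen i) :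
    IsLRChain mu nu lam fun m r => if m = 0 then mu.rowLen r else lam.rowLen r where
  zero r := rfl
  mono m r := by
    rw [if_neg (Nat.succ_ne_zero m)]
    split_ifs
    exacts [h1 r, le_rfl]
  top m r hr := if_neg (by omega)
  strip m r := by
    rw [if_neg (Nat.succ_ne_zero m)]
    split_ifs
    exacts [h2 r, lam.rowLen_anti r (r + 1) (by omega)]
  content m := by
    refine ⟨max (lam.colLen 0) (mu.colLen 0), fun R hR => ?_⟩
    rw [rowLen_of_isSingleRow hnu]
    cases m with
    | zero =>
      simp only [if_true, Nat.succ_ne_zero, if_false]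
      rw [← card_eq_sum_rowLen lam (by omega), ← card_eq_sum_rowLen mu (by omega), hcard]
    | succ m => simp
  ballot m R := by
    simp only [Nat.succ_ne_zero, if_false]
    refine Nat.add_le_add_left (Finset.sum_le_sum fun r _ => ?_) _
    have := h1 r
    split_ifs <;> omega

/-- Stage m fills rows above m completely and puts E m boxes in row m. Label m + 1 thus occurs in
rows m and m + 1 only, and E m − E (m + 1) = λ_m − ν_m gives it multiplicity ν_m. -/
theorem isLRChain_horizontal_inner {mu nu lam : YoungDiagram} (hmu : IsSingleRow mu)
    (hcard : lam.card = mu.card + nu.card) (h1 : ∀ i, nu.rowLen i ≤ lam.rowLen i)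
    (h2 : ∀ i, lam.rowLen (i + 1) ≤ nu.rowLen i) :
    ∃ s, IsLRChain mu nu lam s := by
  obtain ⟨E, hE, hE0, hEcard⟩ := exists_strip_tails h1
  have hle : ∀ n m, lam.colLen 0 ≤ m + n → E m ≤ lam.rowLen m := by
    intro n
    induction n with
    | zero =>
      intro m hm
      rw [hE0 m hm]
      exact Nat.zero_le _
    | succ n ih =>
      intro m hm
      have := ih (m + 1) (by omega)
      have := hE m
      have := h2 m
      omega
  have hle' : ∀ m, E m ≤ lam.rowLen m := fun m => hle (lam.colLen 0) m (by omega)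
  have hsum : ∀ m R, ∑ r ∈ Finset.range R,
      (if r < m then lam.rowLen r else if r = m then E m else 0) =
      if R ≤ m then ∑ r ∈ Finset.range R, lam.rowLen r
      else ∑ r ∈ Finset.range m, lam.rowLen r + E m := by
    intro m R
    induction R with
    | zero => simp
    | succ R ih =>
      rw [Finset.sum_range_succ, ih]
      rcases lt_trichotomy R m with h | h | h
      · rw [if_pos h.le, if_pos h, if_pos (by omega), Finset.sum_range_succ]
      · subst h
        simp
      · rw [if_neg (by omega), if_neg (by omega), if_neg (by omega), if_neg (by omega), add_zero]
  refine ⟨fun m r => if r < m then lam.rowLen r else if r = m then E m else 0, ?_, ?_, ?_, ?_,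
    ?_, ?_⟩
  · intro r
    rw [rowLen_of_isSingleRow hmu]
    simp only [Nat.not_lt_zero, if_false]
    split_ifs <;> omega
  · intro m r
    rcases lt_trichotomy r m with h | h | h
    · simp only [if_pos h, if_pos (Nat.lt_succ_of_lt h), le_refl]
    · subst h
      simpa using hle' r
    · simp only [if_neg h.not_gt, if_neg h.ne', Nat.zero_le]
  · intro m r hr
    exact if_pos hr
  · intro m r
    have := lam.rowLen_anti r (r + 1) (by omega)
    rcases lt_trichotomy r m with h | h | h
    · simp only [if_pos h, if_pos (Nat.succ_lt_succ h), this]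
    · subst h
      have := hE r
      have := h1 r
      have := hle' (r + 1)
      have := h2 r
      simp
      omega
    · simp only [if_neg h.not_gt, if_neg h.ne', if_neg (show ¬ r + 1 < m + 1 by omega),
        if_neg (show ¬ r + 1 = m + 1 by omega), le_refl]
  · intro m
    refine ⟨m + 2, fun R hR => ?_⟩
    have := hE m
    simp only [hsum]
    rw [if_neg (by omega), if_neg (by omega), Finset.sum_range_succ]
    omega
  · intro m R
    simp only [hsum]
    have e1 := Finset.sum_range_succ lam.rowLen m
    have e2 := Finset.sum_range_succ lam.rowLen (m + 1)
    have := hE m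
    have := hE (m + 1)
    have := h2 m
    have := nu.rowLen_anti m (m + 1) (by omega)
    rcases lt_trichotomy R (m + 1) with h | h | h
    · rw [if_pos (by omega), if_pos (by omega), if_pos (by omega), if_pos (by omega)]
    · subst h
      rw [if_pos (by omega), if_neg (by omega), if_neg (by omega), if_pos (by omega)]
      rw [show m + 1 + 1 = m + 2 from rfl] at *
      omega
    · rw [if_neg (by omega), if_neg (by omega), if_neg (by omega), if_neg (by omega)]
      rw [show m + 1 + 1 = m + 2 from rfl] at *
      omega

/-- The strip is filled with 1, 2, 3, … from top to bottom. With e r the number of strip boxes above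
row r, a strip box in row r has label e r + 1. -/
theorem isLRChain_vertical_content {mu nu lam : YoungDiagram} (hnu : IsSingleColumn nu)
    (hcard : lam.card = mu.card + nu.card) (h1 : ∀ i, mu.rowLen i ≤ lam.rowLen i)
    (h2 : ∀ i, lam.rowLen i ≤ mu.rowLen i + 1) :
    ∃ s, IsLRChain mu nu lam s := by
  obtain ⟨e, he⟩ : ∃ e : ℕ → ℕ, ∀ R, ∑ r ∈ Finset.range R, lam.rowLen r =
      ∑ r ∈ Finset.range R, mu.rowLen r + e R :=
    ⟨_, fun R => (Nat.add_sub_of_le (Finset.sum_le_sum fun r _ => h1 r)).symm⟩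
  have he1 : ∀ R, e (R + 1) + mu.rowLen R = e R + lam.rowLen R := by
    intro R
    have e1 := he R
    have e2 := he (R + 1)
    rw [Finset.sum_range_succ, Finset.sum_range_succ] at e2
    omega
  have he0 : e 0 = 0 := by simpa using (he 0).symm
  have hele : ∀ R, e R ≤ R := by
    intro R
    induction R with
    | zero => rw [he0]
    | succ R ih =>
      have := he1 R
      have := h2 R
      omega
  have hsum : ∀ m R, ∑ r ∈ Finset.range R, (if e r < m then lam.rowLen r else mu.rowLen r) =
      ∑ r ∈ Finset.range R, mu.rowLen r + min (e R) m := by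
    intro m R
    induction R with
    | zero => simp [he0]
    | succ R ih =>
      rw [Finset.sum_range_succ, ih, Finset.sum_range_succ]
      have := he1 R
      have := h1 R
      have := h2 R
      split_ifs <;> omega
  refine ⟨fun m r => if e r < m then lam.rowLen r else mu.rowLen r, ?_, ?_, ?_, ?_, ?_, ?_⟩
  · intro r
    simp
  · intro m r
    have := h1 r
    split_ifs <;> omega
  · intro m r hr
    exact if_pos ((hele r).trans_lt hr)
  · intro m r
    have := he1 r
    have := h1 r
    have := lam.rowLen_anti r (r + 1) (by omega)
    have := mu.rowLen_anti r (r + 1) (by omega)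
    split_ifs <;> omega
  · intro m
    refine ⟨max (lam.colLen 0) (mu.colLen 0), fun R hR => ?_⟩
    simp only [hsum]
    rw [rowLen_of_isSingleColumn hnu]
    have e1 := he R
    rw [← card_eq_sum_rowLen lam (by omega), ← card_eq_sum_rowLen mu (by omega)] at e1
    split_ifs <;> omega
  · intro m R
    simp only [hsum]
    have := he1 R
    have := h2 R
    omega

/-- Stage m fills rows above m completely and continues the first column by E m single boxes from
row m on. They fit in `lam` because the strip has at most one box in each row. -/
theorem isLRChain_vertical_inner {mu nu lam : YoungDiagram} (hmu : IsSingleColumn mu)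
    (hcard : lam.card = mu.card + nu.card) (h1 : ∀ i, nu.rowLen i ≤ lam.rowLen i)
    (h2 : ∀ i, lam.rowLen i ≤ nu.rowLen i + 1) :
    ∃ s, IsLRChain mu nu lam s := by
  obtain ⟨E, hE, hE0, hEcard⟩ := exists_strip_tails h1
  have hle : ∀ n m, lam.colLen 0 ≤ m + n → E m + m ≤ max (lam.colLen 0) m := by
    intro n
    induction n with
    | zero =>
      intro m hm
      rw [hE0 m hm]
      omega
    | succ n ih =>
      intro m hm
      rcases le_or_gt (lam.colLen 0) m with hlt | hlt
      · rw [hE0 m hlt]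
        omega
      have := ih (m + 1) (by omega)
      have := hE m
      have := h2 m
      omega
  have hpos : ∀ m r, m ≤ r → r < m + E m → 0 < lam.rowLen r := by
    intro m r hmr hr
    rw [rowLen_pos_iff]
    have := hle (lam.colLen 0) m (by omega)
    omega
  have hstep : ∀ m, E m ≤ E (m + 1) + 1 ∧ E (m + 1) ≤ E m := by
    intro m
    have := hE m
    have := h1 m
    have := h2 m
    omega
  have hsum : ∀ m R, ∑ r ∈ Finset.range R,
      (if r < m then lam.rowLen r else if r < m + E m then 1 else 0) =
      if R ≤ m then ∑ r ∈ Finset.range R, lam.rowLen r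
      else ∑ r ∈ Finset.range m, lam.rowLen r + min (E m) (R - m) := by
    intro m R
    induction R with
    | zero => simp
    | succ R ih =>
      rw [Finset.sum_range_succ, ih]
      rcases lt_trichotomy R m with h | h | h
      · rw [if_pos h.le, if_pos h, if_pos (by omega), Finset.sum_range_succ]
      · subst h
        simp only [le_refl, if_true, lt_irrefl, if_false]
        split_ifs <;> omega
      · rw [if_neg (by omega), if_neg (by omega), if_neg (show ¬ R + 1 ≤ m by omega)]
        split_ifs <;> omega
  refine ⟨fun m r => if r < m then lam.rowLen r else if r < m + E m then 1 else 0, ?_, ?_, ?_,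
    ?_, ?_, ?_⟩
  · intro r
    rw [rowLen_of_isSingleColumn hmu]
    simp only [Nat.not_lt_zero, if_false]
    split_ifs <;> omega
  · intro m r
    have := hpos m r
    have := hstep m
    split_ifs <;> omega
  · intro m r hr
    exact if_pos hr
  · intro m r
    have := lam.rowLen_anti r (r + 1) (by omega)
    have := hstep m
    split_ifs <;> omega
  · intro m
    refine ⟨m + 2 + E m, fun R hR => ?_⟩
    have := hE m
    have := hstep m
    simp only [hsum]
    rw [if_neg (by omega), if_neg (by omega), Finset.sum_range_succ]
    omega
  · intro m R
    simp only [hsum]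
    have e1 := Finset.sum_range_succ lam.rowLen m
    have e2 := Finset.sum_range_succ lam.rowLen (m + 1)
    have := hE m
    have := hE (m + 1)
    have := h2 m
    have := h1 (m + 1)
    have := lam.rowLen_anti m (m + 1) (by omega)
    have := nu.rowLen_anti m (m + 1) (by omega)
    have := hstep m
    have := hstep (m + 1)
    rcases lt_trichotomy R (m + 1) with h | h | h
    · rw [if_pos (by omega), if_pos (by omega), if_pos (by omega), if_pos (by omega)]
    · subst h
      rw [if_pos (by omega), if_neg (by omega), if_neg (by omega), if_pos (by omega)]
      rw [show m + 1 + 1 = m + 2 from rfl] at *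
      omega
    · rw [if_neg (by omega), if_neg (by omega), if_neg (by omega), if_neg (by omega)]
      rw [show m + 1 + 1 = m + 2 from rfl] at *
      omega

/-- Pieri's rule. Having chains for both orders of the factors replaces the symmetry of the
coefficients. -/
theorem hasLRChains_of_horizontal {mu nu lam : YoungDiagram} (hnu : IsSingleRow nu)
    (hcard : lam.card = mu.card + nu.card) (h1 : ∀ i, mu.rowLen i ≤ lam.rowLen i)
    (h2 : ∀ i, lam.rowLen (i + 1) ≤ mu.rowLen i) : HasLRChains mu nu lam :=
  ⟨⟨_, isLRChain_horizontal_content hnu hcard h1 h2⟩,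
    isLRChain_horizontal_inner hnu (by omega) h1 h2⟩

theorem hasLRChains_of_vertical {mu nu lam : YoungDiagram} (hnu : IsSingleColumn nu)
    (hcard : lam.card = mu.card + nu.card) (h1 : ∀ i, mu.rowLen i ≤ lam.rowLen i)
    (h2 : ∀ i, lam.rowLen i ≤ mu.rowLen i + 1) : HasLRChains mu nu lam :=
  ⟨isLRChain_vertical_content hnu hcard h1 h2, isLRChain_vertical_inner hnu (by omega) h1 h2⟩

end NewellLittlewood

/-! ### Partitions with prescribed rows or size, and interpolation -/

namespace NewellLittlewood

theorem exists_rowLen_eq (f : ℕ → ℕ) (hf : Antitone f) (R : ℕ) (hR : f R = 0) :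
    ∃ mu : YoungDiagram, ∀ i, mu.rowLen i = f i := by
  have hlower : IsLowerSet (({c ∈ Finset.range R ×ˢ Finset.range (f 0) | c.2 < f c.1} :
      Finset (ℕ × ℕ)) : Set (ℕ × ℕ)) := by
    rintro ⟨i, j⟩ ⟨i', j'⟩ hle hc
    obtain ⟨hi, hj⟩ := Prod.mk_le_mk.mp hle
    simp only [Finset.coe_filter, Finset.mem_product, Finset.mem_range, Set.mem_ofPred_eq]
      at hc ⊢
    have := hf hi
    omega
  refine ⟨⟨_, hlower⟩, fun i => ?_⟩
  have key : ∀ j, j < YoungDiagram.rowLen ⟨_, hlower⟩ i ↔ j < f i := by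
    intro j
    rw [← YoungDiagram.mem_iff_lt_rowLen, ← YoungDiagram.mem_cells]
    simp only [Finset.mem_filter, Finset.mem_product, Finset.mem_range]
    refine ⟨fun h => h.2, fun h => ⟨⟨?_, h.trans_le (hf (Nat.zero_le i))⟩, h⟩⟩
    by_contra! hi
    have := hf hi
    omega
  exact le_antisymm (Nat.le_of_not_lt fun h => lt_irrefl _ ((key _).mp h))
    (Nat.le_of_not_lt fun h => lt_irrefl _ ((key _).mpr h))

theorem exists_isSingleRow (p : ℕ) : ∃ mu : YoungDiagram, IsSingleRow mu ∧ mu.card = p := by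
  obtain ⟨mu, hmu⟩ := exists_rowLen_eq (fun i => if i = 0 then p else 0)
    (antitone_nat_of_succ_le fun i => by simp) 1 (by simp)
  have h : mu.colLen 0 ≤ 1 := by
    by_contra! hlt
    have := rowLen_pos_iff.mpr hlt
    simp [hmu] at this
  exact ⟨mu, h, by rw [card_eq_sum_rowLen mu h]; simp [hmu]⟩

theorem exists_isSingleColumn (p : ℕ) :
    ∃ mu : YoungDiagram, IsSingleColumn mu ∧ mu.card = p := by
  obtain ⟨mu, hmu⟩ := exists_rowLen_eq (fun i => if i < p then 1 else 0)
    (antitone_nat_of_succ_le fun i => by split_ifs <;> omega) p (by simp)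
  have h : mu.colLen 0 ≤ p := by
    by_contra! hlt
    have := rowLen_pos_iff.mpr hlt
    simp [hmu] at this
  refine ⟨mu, ?_, ?_⟩
  · rw [IsSingleColumn, hmu]
    split_ifs <;> omega
  · rw [card_eq_sum_rowLen mu h, Finset.sum_congr rfl fun i hi =>
      (hmu i).trans (if_pos (Finset.mem_range.mp hi))]
    simp

theorem card_scale (k : ℕ) (mu : YoungDiagram) : (scale k mu).card = k * mu.card := by
  rw [card_eq_sum_rowLen _ (le_max_left ((scale k mu).colLen 0) (mu.colLen 0)),
    card_eq_sum_rowLen _ (le_max_right ((scale k mu).colLen 0) (mu.colLen 0)), Finset.mul_sum]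
  exact Finset.sum_congr rfl fun i _ => rowLen_scale k mu i

theorem exists_card_eq_of_le {L : YoungDiagram} {n : ℕ} (hL : L.card ≤ n) :
    ∀ (d : ℕ) (U : YoungDiagram), U.card = n + d → L ≤ U → ∃ tau, L ≤ tau ∧ tau ≤ U ∧ tau.card = n
  | 0, U, hU, hLU => ⟨U, hLU, le_rfl, hU⟩
  | d + 1, U, hU, hLU => by
    have hne : (U.cells \ L.cells).Nonempty := by
      rw [← Finset.card_pos]
      have := Finset.le_card_sdiff L.cells U.cells
      simp only [YoungDiagram.card] at *
      omega
    -- A maximal cell of U outside L is a corner of U: any cell of U beyond it is also outside L.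
    -- Erasing it leaves a diagram containing L.
    obtain ⟨c, hc⟩ := Finset.exists_maximal hne
    have hcU := (Finset.mem_sdiff.mp hc.prop).1
    have hcL := (Finset.mem_sdiff.mp hc.prop).2
    let V : YoungDiagram := ⟨U.cells.erase c, by
      intro a b hba ha
      simp only [Finset.coe_erase, Set.mem_sdiff, Finset.mem_coe, Set.mem_singleton_iff] at ha ⊢
      refine ⟨U.isLowerSet hba ha.1, ?_⟩
      rintro rfl
      by_cases haL : a ∈ L.cells
      · exact hcL (L.isLowerSet hba haL)
      · exact ha.2 (le_antisymm (hc.le_of_ge (Finset.mem_sdiff.mpr ⟨ha.1, haL⟩) hba) hba)⟩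
    have hV : V.card = n + d := by
      have : V.card = U.card - 1 := Finset.card_erase_of_mem hcU
      omega
    have hLV : L ≤ V := fun x hx => Finset.mem_erase.mpr ⟨fun h => hcL (h ▸ hx), hLU hx⟩
    obtain ⟨tau, h1, h2, h3⟩ := exists_card_eq_of_le hL d V hV hLV
    exact ⟨tau, h1, h2.trans fun x hx => (Finset.mem_erase.mp hx).2, h3⟩

/-- A diagram `tau'` of size `k * n` between the `k`-fold multiples of two antitone sequences
gives a diagram of size `n` between the two sequences. -/
theorem exists_card_eq_between {k n R : ℕ} (hk : 1 ≤ k) {l u : ℕ → ℕ} (hl : Antitone l)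
    (hu : Antitone u) (hR : u R = 0) {tau' : YoungDiagram} (hcard : tau'.card = k * n)
    (hl' : ∀ i, k * l i ≤ tau'.rowLen i) (hu' : ∀ i, tau'.rowLen i ≤ k * u i) :
    ∃ tau : YoungDiagram, tau.card = n ∧ ∀ i, l i ≤ tau.rowLen i ∧ tau.rowLen i ≤ u i := by
  have hlu : ∀ i, l i ≤ u i := fun i =>
    Nat.le_of_mul_le_mul_left ((hl' i).trans (hu' i)) hk
  obtain ⟨L, hL⟩ := exists_rowLen_eq l hl R (by have := hlu R; omega)
  obtain ⟨U, hU⟩ := exists_rowLen_eq u hu R hR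
  have h1 : scale k L ≤ tau' := le_iff_rowLen_le.mpr fun i => by rw [rowLen_scale, hL]; exact hl' i
  have h2 : tau' ≤ scale k U := le_iff_rowLen_le.mpr fun i => by rw [rowLen_scale, hU]; exact hu' i
  have h3 : L.card ≤ n := by
    have := Finset.card_le_card h1
    rw [← YoungDiagram.card, ← YoungDiagram.card, card_scale, hcard] at this
    exact Nat.le_of_mul_le_mul_left this hk
  have h4 : n ≤ U.card := by
    have := Finset.card_le_card h2
    rw [← YoungDiagram.card, ← YoungDiagram.card, card_scale, hcard] at this
    exact Nat.le_of_mul_le_mul_left this hk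
  obtain ⟨tau, h5, h6, h7⟩ := exists_card_eq_of_le h3 (U.card - n) U (by omega)
    (le_iff_rowLen_le.mpr fun i => by rw [hL, hU]; exact hlu i)
  refine ⟨tau, h7, fun i => ⟨?_, ?_⟩⟩
  · rw [← hL]
    exact le_iff_rowLen_le.mp h5 i
  · rw [← hU]
    exact le_iff_rowLen_le.mp h6 i

/-! ### Descent from the scaled triple -/

theorem exists_half_card {k p r s t : ℕ} (hk : 1 ≤ k) (hparity : (p + r + s) % 2 = 0)
    {b c : ℕ} (h1 : k * r = t + b) (h2 : k * s = t + c) (h3 : k * p = b + c) :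
    ∃ n, t = k * n ∧ r + s = 2 * n + p := by
  have h4 : k * (r + s) = 2 * t + k * p := by rw [mul_add]; omega
  have h5 : p ≤ r + s := Nat.le_of_mul_le_mul_left (by omega : k * p ≤ k * (r + s)) hk
  refine ⟨(r + s - p) / 2, ?_, by omega⟩
  have h6 : r + s = 2 * ((r + s - p) / 2) + p := by omega
  generalize (r + s - p) / 2 = n at *
  rw [h6] at h4
  have : k * (2 * n + p) = 2 * (k * n) + k * p := by ring
  omega

/-- Since β' and γ' have no second row, Weyl's inequalities with j = 1 make kρ/τ' and kσ/τ'
horizontal strips; τ' is then replaced by an interpolating τ of size n. -/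
theorem exists_hasLRChains_of_isSingleRow {rho sigma pi tau' beta' gamma' : YoungDiagram} {k : ℕ}
    (hk : 1 ≤ k) (hpi : IsSingleRow pi) (hparity : (pi.card + rho.card + sigma.card) % 2 = 0)
    (h1 : WeylSum tau' beta' (scale k rho)) (h2 : WeylSum tau' gamma' (scale k sigma))
    (h3 : WeylSum beta' gamma' (scale k pi)) :
    ∃ tau beta gamma, HasLRChains tau beta rho ∧ HasLRChains tau gamma sigma ∧
      HasLRChains beta gamma pi := by
  have c1 := h1.card_eq
  have c2 := h2.card_eq
  have c3 := h3.card_eq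
  rw [card_scale] at c1 c2 c3
  obtain ⟨n, hn, hn'⟩ := exists_half_card hk hparity c1 c2 c3
  have hpi1 : (scale k pi).rowLen 1 = 0 := by rw [rowLen_scale, rowLen_of_isSingleRow hpi]; rfl
  have hb := h3.left_le 1
  have hc := h3.right_le 1
  rw [hpi1] at hb hc
  have hk1 : ∀ i, tau'.rowLen i ≤ k * rho.rowLen i := fun i => by
    rw [← rowLen_scale]; exact h1.left_le i
  have hk2 : ∀ i, tau'.rowLen i ≤ k * sigma.rowLen i := fun i => by
    rw [← rowLen_scale]; exact h2.left_le i
  have hk3 : ∀ i, k * rho.rowLen (i + 1) ≤ tau'.rowLen i := fun i => by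
    have := h1.weyl i 1
    rw [rowLen_scale] at this
    omega
  have hk4 : ∀ i, k * sigma.rowLen (i + 1) ≤ tau'.rowLen i := fun i => by
    have := h2.weyl i 1
    rw [rowLen_scale] at this
    omega
  obtain ⟨tau, ht, htau⟩ := exists_card_eq_between hk (R := rho.colLen 0)
    (l := fun i => max (rho.rowLen (i + 1)) (sigma.rowLen (i + 1)))
    (u := fun i => min (rho.rowLen i) (sigma.rowLen i))
    (fun i j h => max_le_max (rho.rowLen_anti _ _ (by omega)) (sigma.rowLen_anti _ _ (by omega)))
    (fun i j h => min_le_min (rho.rowLen_anti _ _ h) (sigma.rowLen_anti _ _ h))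
    (by simp [rowLen_eq_zero (mu := rho) le_rfl]) hn
    (fun i => by rw [mul_max]; exact max_le (hk3 i) (hk4 i))
    (fun i => by rw [mul_min]; exact le_min (hk1 i) (hk2 i))
  have le1 : tau.card ≤ rho.card := Finset.card_le_card (le_iff_rowLen_le.mpr fun i => by
    have := htau i; omega)
  have le2 : tau.card ≤ sigma.card := Finset.card_le_card (le_iff_rowLen_le.mpr fun i => by
    have := htau i; omega)
  obtain ⟨beta, hbeta, hbc⟩ := exists_isSingleRow (rho.card - tau.card)
  obtain ⟨gamma, hgamma, hgc⟩ := exists_isSingleRow (sigma.card - tau.card)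
  refine ⟨tau, beta, gamma,
    hasLRChains_of_horizontal hbeta (by omega) (fun i => ?_) (fun i => ?_),
    hasLRChains_of_horizontal hgamma (by omega) (fun i => ?_) (fun i => ?_),
    hasLRChains_of_horizontal hgamma (by omega) (fun i => ?_) (fun i => ?_)⟩
  · have := htau i; omega
  · have := htau i; omega
  · have := htau i; omega
  · have := htau i; omega
  · rw [rowLen_of_isSingleRow hbeta, rowLen_of_isSingleRow hpi]
    split_ifs <;> omega
  · rw [rowLen_of_isSingleRow hpi, if_neg (Nat.succ_ne_zero i)]
    exact Nat.zero_le _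

theorem exists_hasLRChains_of_isSingleColumn {rho sigma pi tau' beta' gamma' : YoungDiagram}
    {k : ℕ} (hk : 1 ≤ k) (hpi : IsSingleColumn pi)
    (hparity : (pi.card + rho.card + sigma.card) % 2 = 0)
    (h1 : WeylSum tau' beta' (scale k rho)) (h2 : WeylSum tau' gamma' (scale k sigma))
    (h3 : WeylSum beta' gamma' (scale k pi)) :
    ∃ tau beta gamma, HasLRChains tau beta rho ∧ HasLRChains tau gamma sigma ∧
      HasLRChains beta gamma pi := by
  have c1 := h1.card_eq
  have c2 := h2.card_eq
  have c3 := h3.card_eq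
  rw [card_scale] at c1 c2 c3
  obtain ⟨n, hn, hn'⟩ := exists_half_card hk hparity c1 c2 c3
  have hpi0 : (scale k pi).rowLen 0 ≤ k := by
    rw [rowLen_scale]
    exact mul_le_of_le_one_right' hpi
  have hb := (h3.left_le 0).trans hpi0
  have hc := (h3.right_le 0).trans hpi0
  have hk1 : ∀ i, tau'.rowLen i ≤ k * rho.rowLen i := fun i => by
    rw [← rowLen_scale]; exact h1.left_le i
  have hk2 : ∀ i, tau'.rowLen i ≤ k * sigma.rowLen i := fun i => by
    rw [← rowLen_scale]; exact h2.left_le i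
  -- Weyl's inequality with j = 0 and β'_0 ≤ k. If the part is 0, the truncated difference makes the
  -- bound trivial.
  have hk3 : ∀ i, k * (rho.rowLen i - 1) ≤ tau'.rowLen i := fun i => by
    have := h1.weyl i 0
    rw [rowLen_scale, add_zero] at this
    rw [Nat.mul_sub, mul_one]
    omega
  have hk4 : ∀ i, k * (sigma.rowLen i - 1) ≤ tau'.rowLen i := fun i => by
    have := h2.weyl i 0
    rw [rowLen_scale, add_zero] at this
    rw [Nat.mul_sub, mul_one]
    omega
  obtain ⟨tau, ht, htau⟩ := exists_card_eq_between hk (R := rho.colLen 0)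
    (l := fun i => max (rho.rowLen i - 1) (sigma.rowLen i - 1))
    (u := fun i => min (rho.rowLen i) (sigma.rowLen i))
    (fun i j h => max_le_max (Nat.sub_le_sub_right (rho.rowLen_anti _ _ h) 1)
      (Nat.sub_le_sub_right (sigma.rowLen_anti _ _ h) 1))
    (fun i j h => min_le_min (rho.rowLen_anti _ _ h) (sigma.rowLen_anti _ _ h))
    (by simp [rowLen_eq_zero (mu := rho) le_rfl]) hn
    (fun i => by rw [mul_max]; exact max_le (hk3 i) (hk4 i))
    (fun i => by rw [mul_min]; exact le_min (hk1 i) (hk2 i))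
  have le1 : tau.card ≤ rho.card := Finset.card_le_card (le_iff_rowLen_le.mpr fun i => by
    have := htau i; omega)
  have le2 : tau.card ≤ sigma.card := Finset.card_le_card (le_iff_rowLen_le.mpr fun i => by
    have := htau i; omega)
  obtain ⟨beta, hbeta, hbc⟩ := exists_isSingleColumn (rho.card - tau.card)
  obtain ⟨gamma, hgamma, hgc⟩ := exists_isSingleColumn (sigma.card - tau.card)
  refine ⟨tau, beta, gamma,
    hasLRChains_of_vertical hbeta (by omega) (fun i => ?_) (fun i => ?_),
    hasLRChains_of_vertical hgamma (by omega) (fun i => ?_) (fun i => ?_),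
    hasLRChains_of_vertical hgamma (by omega) (fun i => ?_) (fun i => ?_)⟩
  · have := htau i; omega
  · have := htau i; omega
  · have := htau i; omega
  · have := htau i; omega
  · rw [rowLen_of_isSingleColumn hbeta, rowLen_of_isSingleColumn hpi]
    split_ifs <;> omega
  · rw [rowLen_of_isSingleColumn hpi]
    split_ifs <;> omega

theorem exists_hasLRChains {rho sigma pi tau' beta' gamma' : YoungDiagram} {k : ℕ}
    (hk : 1 ≤ k) (hpi : IsSingleRow pi ∨ IsSingleColumn pi)
    (hparity : (pi.card + rho.card + sigma.card) % 2 = 0)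
    (h1 : WeylSum tau' beta' (scale k rho)) (h2 : WeylSum tau' gamma' (scale k sigma))
    (h3 : WeylSum beta' gamma' (scale k pi)) :
    ∃ tau beta gamma, HasLRChains tau beta rho ∧ HasLRChains tau gamma sigma ∧
      HasLRChains beta gamma pi :=
  hpi.elim (fun h => exists_hasLRChains_of_isSingleRow hk h hparity h1 h2 h3)
    fun h => exists_hasLRChains_of_isSingleColumn hk h hparity h1 h2 h3

theorem nlNumber_pos {mu nu lam alpha beta gamma : YoungDiagram}
    (h : 0 < lrCoeff alpha beta mu * lrCoeff alpha gamma nu * lrCoeff beta gamma lam) :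
    0 < nlNumber mu nu lam :=
  h.trans_le (single_le_finsum (alpha, beta, gamma) (nlNumber_support_finite mu nu lam)
    fun _ => Nat.zero_le _)

end NewellLittlewood

theorem theorem5p6 (lam mu nu : YoungDiagram)
    (hshape : (IsSingleRow lam ∨ IsSingleColumn lam) ∨ (IsSingleRow mu ∨ IsSingleColumn mu) ∨
      (IsSingleRow nu ∨ IsSingleColumn nu))
    (hparity : lam.card + mu.card + nu.card ≡ 0 [MOD 2])
    (k : ℕ) (hk : 1 ≤ k)
    (hN : 0 < nlNumber (scale k mu) (scale k nu) (scale k lam)) :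
    0 < nlNumber mu nu lam ∧
      ∃ α β γ : YoungDiagram,
        0 < lrCoeff (scale k α) (scale k β) (scale k mu) *
          lrCoeff (scale k α) (scale k γ) (scale k nu) *
          lrCoeff (scale k β) (scale k γ) (scale k lam) := by
  obtain ⟨⟨α', β', γ'⟩, ht⟩ := not_forall.mp (mt finsum_eq_zero_of_forall_eq_zero hN.ne')
  have h1 := WeylSum.of_lrCoeff (left_ne_zero_of_mul (left_ne_zero_of_mul ht))
  have h2 := WeylSum.of_lrCoeff (right_ne_zero_of_mul (left_ne_zero_of_mul ht))
  have h3 := WeylSum.of_lrCoeff (right_ne_zero_of_mul ht)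
  have hpar : (lam.card + mu.card + nu.card) % 2 = 0 := hparity
  obtain ⟨α, β, γ, c1, c2, c3⟩ : ∃ α β γ, HasLRChains α β mu ∧ HasLRChains α γ nu ∧
      HasLRChains β γ lam := by
    -- The role of τ' goes to the partition that does not occur with the special shape: α' for λ, γ'
    -- for μ, β' for ν.
    rcases hshape with h | h | h
    · exact exists_hasLRChains hk h hpar h1 h2 h3
    · obtain ⟨γ, α, β, c1, c2, c3⟩ :=
        exists_hasLRChains hk h (by omega) h2.symm h3.symm h1
      exact ⟨α, β, γ, c3, c1.symm, c2.symm⟩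
    · obtain ⟨β, α, γ, c1, c2, c3⟩ :=
        exists_hasLRChains hk h (by omega) h1.symm h3 h2
      exact ⟨α, β, γ, c1.symm, c3, c2⟩
  exact ⟨nlNumber_pos (mul_pos (mul_pos c1.lrCoeff_pos c2.lrCoeff_pos) c3.lrCoeff_pos),
    α, β, γ, mul_pos (mul_pos (c1.scale k).lrCoeff_pos (c2.scale k).lrCoeff_pos)
      (c3.scale k).lrCoeff_pos⟩
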